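/- Let $I$ be a finite or countably infinite set and let $(A,\Psi)$ be a Borcherds--Kac--Moody (BKM) supermatrix: $A=(a_{ij})_{i,j\in I}$ is a real matrix and $\Psi\subseteq I$ is a subset (the odd indices) such that, for all $i,j\in I$, (1) $a_{ii}=2$ or $a_{ii}\le 0$; (2) $a_{ij}\le 0$ if $i\ne j$; (3) $a_{ij}=0$ if and only if $a_{ji}=0$; (4) $a_{ij}\in\mathbb Z$ if $a_{ii}=2$; (5) $a_{ij}\in 2\mathbb Z$ if $a_{ii}=2$ and $i\in\Psi$; (6) there are $d_i>0$ with $d_ia_{ij}=d_ja_{ji}$. Put $I^{\mathrm{re}}=\{i: a_{ii}=2\}$, $I^{\mathrm{im}}=I\setminus I^{\mathrm{re}}$, $\Psi_0=\{i\in\Psi: a_{ii}=0\}$. Let $\mathfrak h$ be the complex vector space with basis $\{h_i, D_i: i\in I\}$ (the Cartan subalgebra, extended by the degree derivations), let $\alpha_j\in\mathfrak h^*$ be the simple roots, $\alpha_j(h_i)=a_{ij}$, $\alpha_j(D_i)=\delta_{ij}$, and put $(\lambda,\alpha_i)=d_i\lambda(h_i)$ for $\lambda\in\mathfrak h^*$.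 Let $W\le \mathrm{GL}(\mathfrak h^*)$ be the Weyl group, generated by the reflections $s_i(\lambda)=\lambda-2\frac{(\lambda,\alpha_i)}{(\alpha_i,\alpha_i)}\alpha_i$, $i\in I^{\mathrm{re}}$, with length function $\ell$, and let $\rho\in\mathfrak h^*$ be any element with $2(\rho,\alpha_i)=(\alpha_i,\alpha_i)$ for all $i\in I$. For a finitely supported $\mathbf k=(k_i)_{i\in I}\in\mathbb Z_+[I]$ put $\eta(\mathbf k)=\sum_i k_i\alpha_i$ and $\mathrm{ht}(\eta(\mathbf k))=\sum_i k_i$. Let $\Omega$ be the set of all $\gamma=\sum_i m_i\alpha_i$ with $(m_i)_{i\in I}\in\mathbb Z_+[I]$ such that $m_i=0$ for $i\in I^{\mathrm{re}}$; $m_i\le 1$ for $i\notin\Psi$; $(\alpha_i,\alpha_j)=0$ whenever $i\neq j$ and $m_i,m_j\ne 0$; and $(\alpha_i,\alpha_i)=0$ whenever $i\in\Psi$ and $m_i\ge 2$. Let $$U=\sum_{w\in W}\sum_{\gamma\in\Omega}(-1)^{\ell(w)}(-1)^{\mathrm{ht}(\gamma)}\,e^{w(\rho-\gamma)-\rho}$$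 be the sum side of the denominator identity. Every exponent $w(\rho-\gamma)-\rho$ is of the form $-\eta(\beta)$ with $\beta\in\mathbb Z_+[I]$, each such exponent occurs for only finitely many pairs $(w,\gamma)$, and $U$, regarded as an element of $\mathbb C[[e^{-\alpha_i}: i\in I]]$, is invertible. Let $G$ be the quasi Dynkin diagram of $(A,\Psi)$, i.e. the simple graph with vertex set $I$ in which distinct $i,j$ are adjacent if and only if $a_{ij}\neq 0$. Let $\mathbf k\in\mathbb Z_+[I]$ be free, i.e. $k_i\le 1$ for all $i\in I^{\mathrm{re}}\sqcup\Psi_0$. Then the number of maps $\tau$ from $I$ to the subsets of $\{1,\dots,q\}$ with $|\tau(i)|=k_i$ for all $i$ and $\tau(i)\cap\tau(j)=\emptyset$ for all adjacent $i,j$ is, as a function of $q\in\mathbb Z_{\ge 0}$, given by a (unique) polynomial $\pi^G_{\mathbf k}(q)$, the $\mathbf k$-chromatic polynomial of $G$, and for every $q\in\mathbb Z$ the coefficient of $e^{-\eta(\mathbf k)}$ in $U^q$ is $$U^q[e^{-\eta(\mathbf k)}]=(-1)^{\mathrm{ht}(\eta(\mathbf k))}\,\pi^G_{\mathbf k}(q).$$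 -/

import Mathlib

open Polynomial

noncomputable section

/-- A Borcherds-Kac-Moody supermatrix `(A, Ψ)` indexed by `I`, together with a chosen
symmetrizer `d` (the positive diagonal matrix that makes `A` symmetrizable).
The defining conditions force all entries to be real. -/
structure BKMSupermatrix (I : Type*) where
  A : Matrix I I ℝ
  /-- the set `Ψ` of odd indices -/
  odd : Set I
  /-- the diagonal entries of the symmetrizing matrix -/
  d : I → ℝ
  diag : ∀ i, A i i = 2 ∨ A i i ≤ 0
  off_diag : ∀ i j, i ≠ j → A i j ≤ 0
  zero_iff : ∀ i j, A i j = 0 ↔ A j i = 0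
  integral : ∀ i j, A i i = 2 → ∃ m : ℤ, A i j = m
  even_integral : ∀ i j, A i i = 2 → i ∈ odd → ∃ m : ℤ, A i j = 2 * m
  d_pos : ∀ i, 0 < d i
  symm : ∀ i j, d i * A i j = d j * A j i

/-- The Cartan subalgebra `𝔥 ⊕ D`, with basis the `h_i` and the degree derivations `D_i`
(which make the simple roots linearly independent). -/
abbrev ExtCartan (I : Type*) : Type _ := (I →₀ ℂ) × (I →₀ ℂ)

/-- The space of weights, i.e. the full dual space of the Cartan subalgebra. -/
abbrev WeightSpace (I : Type*) : Type _ := Module.Dual ℂ (ExtCartan I)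

namespace BKMSupermatrix

variable {I : Type*}

/-- The basis element `h_i` of the Cartan subalgebra. -/
def coroot (i : I) : ExtCartan I := (Finsupp.single i 1, 0)

/-- The basis element `D_i` of the Cartan subalgebra. -/
def derivation (i : I) : ExtCartan I := (0, Finsupp.single i 1)

variable (M : BKMSupermatrix I)

/-- The simple root `α_j`, with `α_j(h_i) = a_{ij}` and `α_j(D_i) = δ_{ij}`. -/
def simpleRoot (j : I) : WeightSpace I :=
  LinearMap.coprod (Finsupp.linearCombination ℂ (fun i => (M.A i j : ℂ))) (Finsupp.lapply j)

theorem simpleRoot_coroot (i j : I) : M.simpleRoot j (coroot i) = (M.A i j : ℂ) := by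
  simp [simpleRoot, coroot]

theorem simpleRoot_derivation [DecidableEq I] (i j : I) :
    M.simpleRoot j (derivation i) = if i = j then 1 else 0 := by
  simp [simpleRoot, derivation, Finsupp.single_apply]

/-- The functional `λ ↦ (λ, α_i) = d_i λ(h_i)`; in particular
`(α_j, α_i) = d_i a_{ij} = (α_i, α_j)`. -/
def form (i : I) : Module.Dual ℂ (WeightSpace I) :=
  (M.d i : ℂ) • Module.Dual.eval ℂ (ExtCartan I) (coroot i)

theorem form_apply (i : I) (μ : WeightSpace I) : M.form i μ = (M.d i : ℂ) * μ (coroot i) := by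
  simp [form]

theorem form_simpleRoot (i j : I) :
    M.form i (M.simpleRoot j) = (M.d i : ℂ) * (M.A i j : ℂ) := by
  rw [form_apply, simpleRoot_coroot]

/-- The index set `I^re` of real simple roots. -/
def realIdx : Set I := {i | M.A i i = 2}

/-- The set `Ψ₀` of odd indices with vanishing diagonal entry. -/
def oddNull : Set I := {i | i ∈ M.odd ∧ M.A i i = 0}

/-- The functional `λ ↦ 2 (λ, α_i) / (α_i, α_i)`. -/
def reflFunctional (i : I) : Module.Dual ℂ (WeightSpace I) :=
  (2 / M.form i (M.simpleRoot i)) • M.form i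

theorem reflFunctional_simpleRoot (i : M.realIdx) :
    M.reflFunctional i (M.simpleRoot i) = 2 := by
  have hA : M.A i i = 2 := i.2
  have hd : (M.d i : ℂ) ≠ 0 := by exact_mod_cast (M.d_pos i).ne'
  have h : M.form i (M.simpleRoot i) ≠ 0 := by
    rw [form_simpleRoot, hA]
    simp [hd]
  simp [reflFunctional, div_mul_cancel₀ _ h]

/-- The simple reflection `s_i(λ) = λ - 2 (λ, α_i) / (α_i, α_i) α_i` of a real simple root. -/
def simpleReflection (i : M.realIdx) : WeightSpace I ≃ₗ[ℂ] WeightSpace I :=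
  Module.reflection (M.reflFunctional_simpleRoot i)

theorem simpleReflection_apply (i : M.realIdx) (μ : WeightSpace I) :
    M.simpleReflection i μ =
      μ - (2 * M.form i μ / M.form i (M.simpleRoot i)) • M.simpleRoot i := by
  simp [simpleReflection, Module.reflection_apply, reflFunctional, div_mul_eq_mul_div]

/-- The Weyl group, generated by the simple reflections of the real simple roots. -/
def weylGroup : Subgroup (WeightSpace I ≃ₗ[ℂ] WeightSpace I) :=
  Subgroup.closure (Set.range M.simpleReflection)

/-- The length of a Weyl group element: the least number of simple reflections in a product
that equals it. -/
def length (w : M.weylGroup) : ℕ :=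
  sInf {n | ∃ l : List M.realIdx, l.length = n ∧
    (l.map M.simpleReflection).prod = (w : WeightSpace I ≃ₗ[ℂ] WeightSpace I)}

/-- The height of an element `∑ k_i α_i` of `Q₊`, given by its coefficients. -/
def height (k : I →₀ ℕ) : ℕ := k.sum fun _ n => n

/-- The element `η(k) = ∑ k_i α_i` of `Q₊`. -/
def eta (k : I →₀ ℕ) : WeightSpace I := k.sum fun i n => n • M.simpleRoot i

/-- The set `Ω` of all `γ = ∑ α_{i_j} + ∑ l_{i_k} β_{i_k}`, where the `α_{i_j}` are distinct even
and the `β_{i_k}` distinct odd imaginary simple roots, these simple roots are pairwise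
orthogonal, and `(β_{i_k}, β_{i_k}) = 0` whenever `l_{i_k} ≥ 2`.
Elements are given by their coefficients. -/
def Omega : Set (I →₀ ℕ) :=
  {γ | (∀ i, γ i ≠ 0 → i ∉ M.realIdx) ∧
    (∀ i, i ∉ M.odd → γ i ≤ 1) ∧
    (∀ i j, i ≠ j → γ i ≠ 0 → γ j ≠ 0 → M.form i (M.simpleRoot j) = 0) ∧
    (∀ i, i ∈ M.odd → 2 ≤ γ i → M.form i (M.simpleRoot i) = 0)}

/-- The condition `2 (ρ, α_i) = (α_i, α_i)` for all `i`. -/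
def IsWeylVector (ρ : WeightSpace I) : Prop :=
  ∀ i, 2 * M.form i ρ = M.form i (M.simpleRoot i)

/-- The pairs `(w, γ)` whose term in the sum is a multiple of `e^{-η(β)}`,
i.e. `w(ρ - γ) - ρ = -η(β)`. -/
def termsAt (ρ : WeightSpace I) (β : I →₀ ℕ) : Set (M.weylGroup × M.Omega) :=
  {p | (p.1 : WeightSpace I ≃ₗ[ℂ] WeightSpace I) (ρ - M.eta p.2) - ρ = -M.eta β}

/-- The sum side `U = ∑_{w ∈ W} ∑_{γ ∈ Ω} ε(w) ε(γ) e^{w(ρ - γ) - ρ}` of the denominator identity,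
as a formal power series in the variables `X_i = e^{-α_i}`: the coefficient of
`X^β = e^{-η(β)}` is the sum of the signs over all terms with that exponent. -/
def U (ρ : WeightSpace I) : MvPowerSeries I ℂ := fun β =>
  ∑ᶠ p ∈ M.termsAt ρ β, (-1 : ℂ) ^ M.length p.1 * (-1 : ℂ) ^ height (p.2 : I →₀ ℕ)

/-- The (underlying graph of the) quasi Dynkin diagram. -/
def quasiDynkin : SimpleGraph I where
  Adj i j := i ≠ j ∧ M.A i j ≠ 0
  symm := ⟨fun i j h => ⟨h.1.symm, fun h' => h.2 ((M.zero_iff i j).2 h')⟩⟩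
  loopless := ⟨fun _ h => h.1 rfl⟩

/-- `k` is free: `k_i ≤ 1` for `i ∈ I^re ⊔ Ψ₀`. -/
def IsFree (k : I →₀ ℕ) : Prop := ∀ i ∈ M.realIdx ∪ M.oddNull, k i ≤ 1

end BKMSupermatrix

/-- The proper vertex `k`-multicolorings of `G` with `q` colors. -/
def Multicoloring {I : Type*} (G : SimpleGraph I) (k : I →₀ ℕ) (q : ℕ) : Type _ :=
  {τ : I → Finset (Fin q) //
    (∀ i, (τ i).card = k i) ∧ ∀ i j, G.Adj i j → Disjoint (τ i) (τ j)}

/-- `P` is the `k`-chromatic polynomial of `G`: its value at every `q ∈ ℕ` is the number of proper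
vertex `k`-multicolorings with `q` colors. (These values determine `P`.) -/
def IsChromaticPolynomial {I : Type*} (G : SimpleGraph I) (k : I →₀ ℕ) (P : ℚ[X]) : Prop :=
  ∀ q : ℕ, P.eval (q : ℚ) = (Nat.card (Multicoloring G k q) : ℚ)

end

/-!
A Weyl group element `w` maps a real simple root `α_i` into `Q₊` unless `w s_i` is shorter than
`w`. Hence `w μ ∈ μ - Q₊` for every regular dominant weight `μ`, such as `ρ - γ` with `γ ∈ Ω`, and
`w μ = μ` only for `w = 1`, so that each exponent `w(ρ - γ) - ρ` comes from only one pair `(w, γ)`.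

Let `β` be free. If `w(ρ - γ) = ρ - η(β)` with `w ≠ 1`, this weight is negative at some real coroot
`h_i`. As `β_i ≤ 1`, this forces `β_i = 1` and `a_{ij} = 0` for all other `j` in the support of `β`,
and `s_i` just removes `α_i` from `η(β)`. Peeling off real simple roots in this way shows that the
exponents of `U` in free degrees are the indicator functions of independent sets of the quasi Dynkin
diagram, with sign `(-1) ^ |β|`.

The `q`-th power of such a signed independence series counts multicolorings by their
`q` color classes, and the binomial series makes the coefficients of `U ^ q` polynomial in `q ∈ ℤ`.
-/

noncomputable section

/-! ### The root lattice -/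

namespace BKMSupermatrix

variable {I : Type*} (M : BKMSupermatrix I)

theorem A_self (i : M.realIdx) : M.A i i = 2 := i.2

theorem simpleRoot_coroot_self (i : M.realIdx) : M.simpleRoot (i : I) (coroot (i : I)) = 2 := by
  simp [simpleRoot_coroot, M.A_self i]

theorem simpleRoot_derivation_self (i : I) : M.simpleRoot i (derivation i) = 1 := by
  classical rw [simpleRoot_derivation, if_pos rfl]

theorem simpleRoot_derivation_of_ne {i j : I} (h : i ≠ j) :
    M.simpleRoot j (derivation i) = 0 := by
  classical rw [simpleRoot_derivation, if_neg h]

theorem eta_eq_linearCombination (c : I →₀ ℕ) :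
    M.eta c = Finsupp.linearCombination ℕ M.simpleRoot c := rfl

@[simp] theorem eta_zero : M.eta 0 = 0 := by simp [eta_eq_linearCombination]

theorem eta_add (b c : I →₀ ℕ) : M.eta (b + c) = M.eta b + M.eta c := by
  simp [eta_eq_linearCombination]

theorem eta_nsmul (n : ℕ) (c : I →₀ ℕ) : M.eta (n • c) = n • M.eta c := by
  simp [eta_eq_linearCombination]

theorem eta_single (i : I) (n : ℕ) : M.eta (Finsupp.single i n) = n • M.simpleRoot i := by
  simp [eta_eq_linearCombination]

theorem eta_derivation (c : I →₀ ℕ) (i : I) : M.eta c (derivation i) = c i := by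
  classical
  simp +contextual [eta, Finsupp.sum, LinearMap.sum_apply, simpleRoot_derivation]

theorem eta_injective : Function.Injective M.eta := fun b c h => by
  ext i
  exact_mod_cast M.eta_derivation b i ▸ M.eta_derivation c i ▸
    congrArg (fun μ : WeightSpace I => μ (derivation i)) h

theorem eta_coroot (c : I →₀ ℕ) (i : I) :
    M.eta c (coroot i) = ((c.sum fun j n => n * M.A i j : ℝ) : ℂ) := by
  simp [eta, Finsupp.sum, LinearMap.sum_apply, simpleRoot_coroot]

theorem exists_int_eta_coroot (c : I →₀ ℕ) (i : M.realIdx) :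
    ∃ z : ℤ, M.eta c (coroot (i : I)) = z := by
  choose a ha using fun j => M.integral i j i.2
  exact ⟨c.sum fun j n => n * a j, by simp [eta_coroot, ha, Finsupp.sum]⟩

theorem mul_A_nonpos {c : I →₀ ℕ} {i : I} (hi : c i = 0) (j : I) : c j * M.A i j ≤ 0 := by
  rcases eq_or_ne i j with rfl | hij
  · simp [hi]
  · exact mul_nonpos_of_nonneg_of_nonpos (Nat.cast_nonneg _) (M.off_diag i j hij)

theorem exists_nat_eta_coroot {c : I →₀ ℕ} {i : M.realIdx} (hi : c i = 0) :
    ∃ n : ℕ, M.eta c (coroot (i : I)) = -n := by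
  obtain ⟨z, hz⟩ := M.exists_int_eta_coroot c i
  have hsum : (c.sum fun j n => n * M.A i j) = z := by
    rw [eta_coroot] at hz
    exact_mod_cast hz
  have hz0 : (z : ℝ) ≤ 0 := hsum.symm.trans_le (Finset.sum_nonpos fun j _ => M.mul_A_nonpos hi j)
  obtain ⟨n, rfl⟩ := Int.exists_eq_neg_ofNat (Int.cast_nonpos.1 hz0)
  exact ⟨n, by simpa using hz⟩

theorem eta_coroot_eq_zero_iff {c : I →₀ ℕ} {i : I} (hi : c i = 0) :
    M.eta c (coroot i) = 0 ↔ ∀ j, c j ≠ 0 → M.A i j = 0 := by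
  rw [eta_coroot, Complex.ofReal_eq_zero, Finsupp.sum,
    Finset.sum_eq_zero_iff_of_nonpos fun j _ => M.mul_A_nonpos hi j]
  simp +contextual

/-- The linear combination `∑ c_i α_i`, for complex coefficients `c`. -/
def rootVector : (I →₀ ℂ) →ₗ[ℂ] WeightSpace I := Finsupp.linearCombination ℂ M.simpleRoot

/-- The functional `λ ↦ (λ, ∑ c_i α_i)`. It is indexed by the coefficients `c` instead of the
weight `∑ c_i α_i`, because the form `(λ, μ)` is defined only when one argument lies in the span
of the simple roots. -/
def rootForm : (I →₀ ℂ) →ₗ[ℂ] Module.Dual ℂ (WeightSpace I) := Finsupp.linearCombination ℂ M.form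

@[simp] theorem rootVector_single (i : I) (t : ℂ) :
    M.rootVector (Finsupp.single i t) = t • M.simpleRoot i := by simp [rootVector]

@[simp] theorem rootForm_single (i : I) (t : ℂ) :
    M.rootForm (Finsupp.single i t) = t • M.form i := by simp [rootForm]

theorem rootVector_derivation (c : I →₀ ℂ) (i : I) : M.rootVector c (derivation i) = c i := by
  classical
  simp [rootVector, Finsupp.linearCombination_apply, Finsupp.sum, LinearMap.sum_apply,
    simpleRoot_derivation, eq_comm]

theorem rootVector_injective : Function.Injective M.rootVector := fun b c h => by
  ext i
  rw [← M.rootVector_derivation b, h, rootVector_derivation]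

theorem rootForm_simpleRoot (c : I →₀ ℂ) (i : I) :
    M.rootForm c (M.simpleRoot i) = M.form i (M.rootVector c) := by
  induction c using Finsupp.induction_linear with
  | zero => simp
  | add b c hb hc => simp [hb, hc]
  | single j t =>
    have hsymm : (M.d j : ℂ) * M.A j i = M.d i * M.A i j := by exact_mod_cast M.symm j i
    simp [form_simpleRoot, hsymm]

/-! ### Words and lengths in the Weyl group -/

variable {M}

theorem simpleReflection_eq (i : M.realIdx) (μ : WeightSpace I) :
    M.simpleReflection i μ = μ - μ (coroot (i : I)) • M.simpleRoot i := by
  have hd : (M.d i : ℂ) ≠ 0 := by exact_mod_cast (M.d_pos i).ne'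
  rw [simpleReflection_apply, form_apply, form_simpleRoot, A_self]
  congr 2
  push_cast
  field_simp

variable (M) in
/-- The simple reflection `s_i` as an element of the Weyl group. -/
def weylReflection (i : M.realIdx) : M.weylGroup :=
  ⟨M.simpleReflection i, Subgroup.subset_closure ⟨i, rfl⟩⟩

theorem weylReflection_smul (i : M.realIdx) (μ : WeightSpace I) :
    M.weylReflection i • μ = μ - μ (coroot (i : I)) • M.simpleRoot i :=
  simpleReflection_eq i μ

theorem weylGroup_ext {v w : M.weylGroup} (h : ∀ μ : WeightSpace I, v • μ = w • μ) : v = w :=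
  Subtype.ext (LinearEquiv.ext h)

theorem weylReflection_mul_self (i : M.realIdx) : M.weylReflection i * M.weylReflection i = 1 :=
  weylGroup_ext fun μ => Module.involutive_reflection (M.reflFunctional_simpleRoot i) μ

@[simp] theorem weylReflection_inv (i : M.realIdx) : (M.weylReflection i)⁻¹ = M.weylReflection i :=
  inv_eq_of_mul_eq_one_right (weylReflection_mul_self i)

theorem weylReflection_ne_one (i : M.realIdx) : M.weylReflection i ≠ 1 := fun h => by
  have hfix : M.simpleRoot (i : I) = M.simpleRoot i - (2 : ℂ) • M.simpleRoot i := by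
    simpa [h, simpleRoot_coroot_self] using weylReflection_smul i (M.simpleRoot i)
  have hcoord := congrArg (fun μ : WeightSpace I => μ (derivation (i : I))) hfix
  norm_num [simpleRoot_derivation_self] at hcoord

theorem mul_weylReflection_smul (w : M.weylGroup) (i : M.realIdx) (μ : WeightSpace I) :
    (w * M.weylReflection i) • μ = w • μ - μ (coroot (i : I)) • w • M.simpleRoot i := by
  rw [mul_smul, weylReflection_smul, smul_sub, smul_comm w]

variable (M) in
/-- The Weyl group element represented by a word in the real indices. -/
def wordProd (l : List M.realIdx) : M.weylGroup := (l.map M.weylReflection).prod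

@[simp] theorem wordProd_nil : M.wordProd [] = 1 := rfl

@[simp] theorem wordProd_cons (i : M.realIdx) (l : List M.realIdx) :
    M.wordProd (i :: l) = M.weylReflection i * M.wordProd l := by simp [wordProd]

theorem wordProd_append (l l' : List M.realIdx) :
    M.wordProd (l ++ l') = M.wordProd l * M.wordProd l' := by simp [wordProd]

theorem coe_wordProd (l : List M.realIdx) :
    (M.wordProd l : WeightSpace I ≃ₗ[ℂ] WeightSpace I) = (l.map M.simpleReflection).prod := by
  simp [wordProd, weylReflection, Function.comp_def]

theorem exists_wordProd (w : M.weylGroup) : ∃ l, M.wordProd l = w := by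
  obtain ⟨w, hw⟩ := w
  induction hw using Subgroup.closure_induction with
  | mem _ hx =>
    obtain ⟨i, rfl⟩ := hx
    exact ⟨[i], by simp [weylReflection]⟩
  | one => exact ⟨[], rfl⟩
  | mul x y hx hy ihx ihy =>
    obtain ⟨l, hl⟩ := ihx
    obtain ⟨l', hl'⟩ := ihy
    exact ⟨l ++ l', by rw [wordProd_append, hl, hl']; rfl⟩
  | inv x hx ih =>
    obtain ⟨l, hl⟩ := ih
    refine ⟨l.reverse, ?_⟩
    change _ = (⟨x, hx⟩ : M.weylGroup)⁻¹
    rw [← hl, wordProd, wordProd, List.prod_inv_reverse, List.map_reverse, List.map_map]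
    simp [Function.comp_def]

theorem length_wordProd_le (l : List M.realIdx) : M.length (M.wordProd l) ≤ l.length :=
  Nat.sInf_le ⟨l, rfl, (coe_wordProd l).symm⟩

theorem exists_reduced_word (w : M.weylGroup) : ∃ l, M.wordProd l = w ∧ l.length = M.length w := by
  obtain ⟨l₀, rfl⟩ := exists_wordProd w
  obtain ⟨l, hl, hw⟩ := Nat.sInf_mem (s := {n | ∃ l : List M.realIdx, l.length = n ∧
      (l.map M.simpleReflection).prod = (M.wordProd l₀ : WeightSpace I ≃ₗ[ℂ] WeightSpace I)})
    ⟨_, l₀, rfl, (coe_wordProd l₀).symm⟩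
  exact ⟨l, Subtype.ext ((coe_wordProd l).trans hw), hl⟩

@[simp] theorem length_one : M.length 1 = 0 := Nat.le_zero.1 (length_wordProd_le [])

theorem length_mul_wordProd_le (w : M.weylGroup) (l : List M.realIdx) :
    M.length (w * M.wordProd l) ≤ M.length w + l.length := by
  obtain ⟨l', rfl, hl'⟩ := exists_reduced_word w
  rw [← wordProd_append, ← hl', ← List.length_append]
  exact length_wordProd_le _

theorem length_weylReflection_mul_le (i : M.realIdx) (w : M.weylGroup) :
    M.length (M.weylReflection i * w) ≤ M.length w + 1 := by
  obtain ⟨l, rfl, hl⟩ := exists_reduced_word w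
  rw [← wordProd_cons, ← hl]
  exact length_wordProd_le _

theorem exists_length_mul_weylReflection_lt {w : M.weylGroup} (hw : w ≠ 1) :
    ∃ i, M.length (w * M.weylReflection i) < M.length w := by
  obtain ⟨l, rfl, hl⟩ := exists_reduced_word w
  rcases List.eq_nil_or_concat' l with rfl | ⟨l, i, rfl⟩
  · exact absurd rfl hw
  · have hcancel : M.wordProd (l ++ [i]) * M.weylReflection i = M.wordProd l := by
      simp [wordProd_append, mul_assoc, weylReflection_mul_self]
    refine ⟨i, ?_⟩
    rw [hcancel, ← hl, List.length_append, List.length_singleton]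
    exact Nat.lt_succ_of_le (length_wordProd_le l)

theorem wordProd_smul_derivation {l : List M.realIdx} {i : I} (hi : ∀ j ∈ l, i ≠ j)
    (μ : WeightSpace I) : (M.wordProd l • μ) (derivation i) = μ (derivation i) := by
  induction l with
  | nil => simp
  | cons j l ih =>
    simp [mul_smul, weylReflection_smul, simpleRoot_derivation_of_ne _ (hi j (by simp)),
      ih fun k hk => hi k (by simp [hk])]

theorem smul_derivation (w : M.weylGroup) {i : I} (hi : i ∉ M.realIdx) (μ : WeightSpace I) :
    (w • μ) (derivation i) = μ (derivation i) := by
  obtain ⟨l, rfl⟩ := exists_wordProd w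
  exact wordProd_smul_derivation (fun j _ h => hi (by simp [h])) μ

theorem exists_smul_rootVector (w : M.weylGroup) (c : I →₀ ℂ) :
    ∃ c', w • M.rootVector c = M.rootVector c' ∧
      ∀ μ, M.rootForm c' (w • μ) = M.rootForm c μ := by
  obtain ⟨l, rfl⟩ := exists_wordProd w
  induction l with
  | nil => exact ⟨c, by simp⟩
  | cons i l ih =>
    obtain ⟨b, hb, hform⟩ := ih
    refine ⟨b - Finsupp.single (i : I) (M.rootVector b (coroot (i : I))), ?_, fun μ => ?_⟩
    · rw [wordProd_cons, mul_smul, hb, weylReflection_smul, map_sub, rootVector_single]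
    · rw [← hform, wordProd_cons, mul_smul, weylReflection_smul]
      simp only [map_sub, map_smul, rootForm_simpleRoot, rootForm_single, form_apply,
        simpleRoot_coroot_self, LinearMap.sub_apply, LinearMap.smul_apply, smul_eq_mul]
      ring

theorem rootForm_smul {w : M.weylGroup} {c c' : I →₀ ℂ}
    (h : w • M.rootVector c = M.rootVector c') (μ : WeightSpace I) :
    M.rootForm c' (w • μ) = M.rootForm c μ := by
  obtain ⟨b, hb, hform⟩ := exists_smul_rootVector w c
  rw [M.rootVector_injective (h.symm.trans hb), hform]

theorem form_eq_of_smul_simpleRoot_eq_add {w : M.weylGroup} {i j k : I} {x y : ℂ}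
    (h : w • M.simpleRoot i = x • M.simpleRoot j + y • M.simpleRoot k) (μ : WeightSpace I) :
    M.form i μ = x * M.form j (w • μ) + y * M.form k (w • μ) := by
  have hroot : w • M.rootVector (Finsupp.single i 1) =
      M.rootVector (Finsupp.single j x + Finsupp.single k y) := by simpa using h
  simpa using (rootForm_smul hroot μ).symm

/-! ### Positivity of roots -/

theorem weylReflection_mul_eq_of_smul_simpleRoot {v : M.weylGroup} {i k : M.realIdx} {x : ℂ}
    (h : v • M.simpleRoot (i : I) = x • M.simpleRoot (k : I)) :
    M.weylReflection k * v = v * M.weylReflection i := by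
  have hform (μ : WeightSpace I) : M.d i * μ (coroot (i : I)) =
      x * (M.d k * (v • μ) (coroot (k : I))) := by
    have hadd : v • M.simpleRoot (i : I) = x • M.simpleRoot (k : I) + (0 : ℂ) • M.simpleRoot k := by
      simpa using h
    simpa [form_apply] using form_eq_of_smul_simpleRoot_eq_add hadd μ
  have hd : (M.d i : ℂ) ≠ 0 := by exact_mod_cast (M.d_pos i).ne'
  have hnorm : (M.d i : ℂ) = x ^ 2 * M.d k := by
    have := hform (M.simpleRoot i)
    rw [h] at this
    simp only [simpleRoot_coroot_self, LinearMap.smul_apply, smul_eq_mul] at this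
    linear_combination this / 2
  refine weylGroup_ext fun μ => ?_
  have hcoroot : μ (coroot (i : I)) * x = (v • μ) (coroot (k : I)) := by
    apply mul_left_cancel₀ hd
    linear_combination x * hform μ - (v • μ) (coroot (k : I)) * hnorm
  rw [mul_weylReflection_smul, mul_smul, weylReflection_smul, h, smul_smul, hcoroot]

theorem d_eq_of_smul_simpleRoot {v : M.weylGroup} {i k k' : M.realIdx} {x y : ℝ}
    (h : v • M.simpleRoot (i : I) = (x : ℂ) • M.simpleRoot k + (y : ℂ) • M.simpleRoot k') :
    M.d i = M.d k * (x * (x + M.A k k' * y)) + M.d k' * y ^ 2 := by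
  have hnorm := form_eq_of_smul_simpleRoot_eq_add h (M.simpleRoot i)
  have hsymm : (M.d k : ℂ) * M.A k k' = M.d k' * M.A k' k := by exact_mod_cast M.symm k k'
  rw [h] at hnorm
  simp only [form_apply, LinearMap.add_apply, LinearMap.smul_apply, simpleRoot_coroot, A_self,
    smul_eq_mul] at hnorm
  push_cast at hnorm
  have hC : (M.d i : ℂ) = M.d k * (x * (x + M.A k k' * y)) + M.d k' * y ^ 2 := by
    linear_combination hnorm / 2 - x * y / 2 * hsymm
  exact_mod_cast hC

/-- The case where `s_k` makes the coefficient of `α_k` negative is excluded by the norm: there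
`d_i = d_k x (x + a y) + d_{k'} y²` with `x (x + a y) ≥ 1`, which forces `y = 0`. -/
theorem weylReflection_mul_smul_simpleRoot {v : M.weylGroup} {i k k' : M.realIdx} (hk : k ≠ k')
    (hi : i = k ∨ i = k') {x y : ℕ}
    (h : v • M.simpleRoot (i : I) = x • M.simpleRoot (k : I) + y • M.simpleRoot (k' : I)) :
    (∃ z : ℕ, (M.weylReflection k * v) • M.simpleRoot (i : I) =
        z • M.simpleRoot (k : I) + y • M.simpleRoot (k' : I)) ∨
      M.weylReflection k * v = v * M.weylReflection i := by
  obtain ⟨a, ha⟩ := M.integral k k' k.2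
  simp only [← Nat.cast_smul_eq_nsmul ℂ] at h ⊢
  rcases le_or_gt ((x : ℤ) + a * y) 0 with hneg | hpos
  · obtain ⟨z, hz⟩ := Int.exists_eq_neg_ofNat hneg
    have hzC : (z : ℂ) = -(x + a * y) := by
      exact_mod_cast congrArg (Int.cast : ℤ → ℂ) (neg_eq_iff_eq_neg.2 hz).symm
    refine Or.inl ⟨z, ?_⟩
    rw [mul_smul, weylReflection_smul, h]
    simp only [LinearMap.add_apply, LinearMap.smul_apply, simpleRoot_coroot, A_self, ha, hzC,
      smul_eq_mul]
    push_cast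
    module
  · right
    have ha0 : M.A k k' ≤ 0 := M.off_diag _ _ fun h => hk (Subtype.ext h)
    have hposR : (1 : ℝ) ≤ x + M.A k k' * y := by rw [ha]; exact_mod_cast hpos
    have hnorm := d_eq_of_smul_simpleRoot (x := x) (y := y) (by exact_mod_cast h)
    have hy : y = 0 := by
      by_contra hy
      have hy1 : (1 : ℝ) ≤ y := by exact_mod_cast Nat.one_le_iff_ne_zero.2 hy
      have hx1 : (1 : ℝ) ≤ x := by nlinarith
      have hdk := M.d_pos k
      have hdk' := M.d_pos k'
      have hk_le : M.d k ≤ M.d k * (x * (x + M.A k k' * y)) :=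
        le_mul_of_one_le_right hdk.le (one_le_mul_of_one_le_of_one_le hx1 hposR)
      have hk'_le : M.d k' ≤ M.d k' * y ^ 2 :=
        le_mul_of_one_le_right hdk'.le (one_le_pow₀ hy1)
      rcases hi with rfl | rfl <;> linarith
    exact weylReflection_mul_eq_of_smul_simpleRoot (x := x) (by simpa [hy] using h)

theorem wordProd_smul_simpleRoot_nonneg_or {i j : M.realIdx} (hij : i ≠ j) {l : List M.realIdx}
    (hl : ∀ k ∈ l, k = i ∨ k = j) :
    (∃ x y : ℕ, M.wordProd l • M.simpleRoot (i : I) =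
        x • M.simpleRoot (i : I) + y • M.simpleRoot (j : I)) ∨
      ∃ l', l'.length < l.length ∧ M.wordProd l' = M.wordProd l * M.weylReflection i := by
  induction l with
  | nil => exact Or.inl ⟨1, 0, by simp⟩
  | cons k l ih =>
    rcases ih fun k hk => hl k (by simp [hk]) with ⟨x, y, hroot⟩ | ⟨l', hlt, hl'⟩
    · have hshorter (h : M.weylReflection k * M.wordProd l = M.wordProd l * M.weylReflection i) :
          ∃ l', l'.length < (k :: l).length ∧
            M.wordProd l' = M.wordProd (k :: l) * M.weylReflection i :=
        ⟨l, by simp, by rw [wordProd_cons, h, mul_assoc, weylReflection_mul_self, mul_one]⟩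
      rw [wordProd_cons]
      rcases hl k (by simp) with rfl | rfl
      · exact (weylReflection_mul_smul_simpleRoot hij (Or.inl rfl) hroot).imp
          (fun ⟨z, hz⟩ => ⟨z, y, hz⟩) hshorter
      · rw [add_comm] at hroot
        exact (weylReflection_mul_smul_simpleRoot hij.symm (Or.inr rfl) hroot).imp
          (fun ⟨z, hz⟩ => ⟨x, z, by rw [hz, add_comm]⟩) hshorter
    · exact Or.inr ⟨k :: l', by simpa using hlt, by simp [hl', mul_assoc]⟩

theorem exists_parabolic_factorization (J : Set M.realIdx) (w : M.weylGroup) :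
    ∃ (u : M.weylGroup) (l : List M.realIdx), w = u * M.wordProd l ∧ (∀ j ∈ l, j ∈ J) ∧
      M.length u + l.length ≤ M.length w ∧
      ∀ j ∈ J, M.length u ≤ M.length (u * M.weylReflection j) := by
  induction hn : M.length w using Nat.strong_induction_on generalizing w with
  | _ n ih =>
    subst hn
    by_cases hdesc : ∃ j ∈ J, M.length (w * M.weylReflection j) < M.length w
    · obtain ⟨j, hj, hlt⟩ := hdesc
      obtain ⟨u, l, hw, hl, hlen, hu⟩ := ih _ hlt _ rfl
      refine ⟨u, l ++ [j], ?_, ?_, ?_, hu⟩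
      · rw [wordProd_append, ← mul_assoc, ← hw]
        simp [mul_assoc, weylReflection_mul_self]
      · rintro k hk
        rcases List.mem_append.1 hk with hk | hk
        · exact hl k hk
        · exact List.mem_singleton.1 hk ▸ hj
      · rw [List.length_append, List.length_singleton]
        omega
    · push Not at hdesc
      exact ⟨w, [], by simp, by simp, by simp, hdesc⟩

theorem smul_simpleRoot_nonneg_or (w : M.weylGroup) (i : M.realIdx) :
    (∃ c, w • M.simpleRoot (i : I) = M.eta c) ∨
      M.length (w * M.weylReflection i) < M.length w := by
  induction hn : M.length w using Nat.strong_induction_on generalizing w i with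
  | _ n ih =>
    subst hn
    rcases eq_or_ne w 1 with rfl | hw1
    · exact Or.inl ⟨Finsupp.single (i : I) 1, by simp [eta_single]⟩
    obtain ⟨j, hj⟩ := exists_length_mul_weylReflection_lt hw1
    rcases eq_or_ne i j with rfl | hij
    · exact Or.inr hj
    obtain ⟨u, l, rfl, hl, hlen, hu⟩ := exists_parabolic_factorization {i, j} w
    have hu_lt : M.length u < M.length (u * M.wordProd l) := by
      have hl0 : l ≠ [] := by
        rintro rfl
        exact hj.not_ge (by simpa using hu j (by simp))
      have := List.length_pos_iff.2 hl0
      omega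
    have hpos (k) (hk : k ∈ ({i, j} : Set M.realIdx)) : ∃ c, u • M.simpleRoot (k : I) = M.eta c :=
      (ih _ hu_lt u k rfl).resolve_right (hu k hk).not_gt
    rcases wordProd_smul_simpleRoot_nonneg_or hij hl with ⟨x, y, hroot⟩ | ⟨l', hlt, hl'⟩
    · obtain ⟨b, hb⟩ := hpos i (by simp)
      obtain ⟨c, hc⟩ := hpos j (by simp)
      refine Or.inl ⟨x • b + y • c, ?_⟩
      rw [mul_smul, hroot, smul_add, smul_comm u x, smul_comm u y, hb, hc, eta_add, eta_nsmul,
        eta_nsmul]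
    · right
      rw [mul_assoc, ← hl']
      exact (length_mul_wordProd_le u l').trans_lt (by omega)

theorem exists_smul_simpleRoot_eq_eta {w : M.weylGroup} (hw : w ≠ 1) :
    ∃ v i c, w = v * M.weylReflection i ∧ M.length v < M.length w ∧
      v • M.simpleRoot (i : I) = M.eta c := by
  obtain ⟨i, hi⟩ := exists_length_mul_weylReflection_lt hw
  have hw' : w = w * M.weylReflection i * M.weylReflection i := by
    rw [mul_assoc, weylReflection_mul_self, mul_one]
  have hnot : ¬ M.length (w * M.weylReflection i * M.weylReflection i) <
      M.length (w * M.weylReflection i) := by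
    rw [← hw']
    exact hi.not_gt
  obtain ⟨c, hc⟩ := (smul_simpleRoot_nonneg_or _ i).resolve_right hnot
  exact ⟨_, i, c, hw', hi, hc⟩

end BKMSupermatrix

/-! ### Independent sets -/

/-- `β` is the indicator function of a finite independent set of vertices of `G`. -/
def IsIndepIndicator {I : Type*} (G : SimpleGraph I) (β : I →₀ ℕ) : Prop :=
  (∀ i, β i ≤ 1) ∧ ∀ i j, G.Adj i j → β i = 0 ∨ β j = 0

open Classical in
/-- The signed independence series `∑ (-1) ^ |S| X^S` of `G`, the sum running over the finite
independent sets `S` of vertices. -/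
def indepSeries {I : Type*} (R : Type*) [CommRing R] (G : SimpleGraph I) : MvPowerSeries I R :=
  fun β => if IsIndepIndicator G β then (-1) ^ BKMSupermatrix.height β else 0

open Classical in
theorem coeff_indepSeries {I R : Type*} [CommRing R] (G : SimpleGraph I) (β : I →₀ ℕ) :
    MvPowerSeries.coeff β (indepSeries R G) =
      if IsIndepIndicator G β then (-1) ^ BKMSupermatrix.height β else 0 :=
  rfl

theorem constantCoeff_indepSeries {I R : Type*} [CommRing R] (G : SimpleGraph I) :
    MvPowerSeries.constantCoeff (indepSeries R G) = 1 := by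
  have h0 : IsIndepIndicator G 0 := ⟨by simp, by simp⟩
  rw [← MvPowerSeries.coeff_zero_eq_constantCoeff_apply, coeff_indepSeries, if_pos h0]
  simp [BKMSupermatrix.height]

theorem isIndepIndicator_add_single {I : Type*} {G : SimpleGraph I} {β : I →₀ ℕ} {i : I}
    (hi : β i = 0) :
    IsIndepIndicator G (β + Finsupp.single i 1) ↔
      IsIndepIndicator G β ∧ ∀ j, β j ≠ 0 → ¬ G.Adj i j := by
  classical
  constructor
  · rintro ⟨hle, hindep⟩
    refine ⟨⟨fun j => le_self_add.trans (hle j), fun j k hjk => ?_⟩, fun j hj hadj => ?_⟩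
    · exact (hindep j k hjk).imp (by simp +contextual) (by simp +contextual)
    · simpa [hi, hj] using hindep i j hadj
  · rintro ⟨⟨hle, hindep⟩, hnbr⟩
    refine ⟨fun j => ?_, fun j k hjk => ?_⟩
    · rcases eq_or_ne i j with rfl | hij
      · simp [hi]
      · simpa [Finsupp.single_eq_of_ne' hij] using hle j
    · have hk0 : i = j → β k = 0 := by rintro rfl; exact by_contra fun h => hnbr k h hjk
      have hj0 : i = k → β j = 0 := by rintro rfl; exact by_contra fun h => hnbr j h hjk.symm
      have hne := hjk.ne
      have := hindep j k hjk
      simp only [Finsupp.add_apply, Finsupp.single_apply]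
      grind

theorem exists_eq_add_single_of_apply_eq_one {I : Type*} {β : I →₀ ℕ} {i : I} (hi : β i = 1) :
    ∃ β', β' i = 0 ∧ β = β' + Finsupp.single i 1 :=
  ⟨β.erase i, Finsupp.erase_same, by rw [← hi, Finsupp.erase_add_single]⟩

/-! ### Regular dominant weights -/

namespace BKMSupermatrix

variable {I : Type*} {M : BKMSupermatrix I}

variable (M) in
/-- A weight taking positive integral values on the real simple coroots. -/
def IsRegularDominant (μ : WeightSpace I) : Prop :=
  ∀ i : M.realIdx, ∃ m : ℕ, μ (coroot (i : I)) = m + 1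

namespace IsRegularDominant

variable {μ : WeightSpace I} (hμ : M.IsRegularDominant μ)

include hμ

theorem exists_smul_eq_sub_eta (w : M.weylGroup) :
    ∃ c, w • μ = μ - M.eta c ∧ (c = 0 → w = 1) := by
  induction hn : M.length w using Nat.strong_induction_on generalizing w with
  | _ n ih =>
    subst hn
    rcases eq_or_ne w 1 with rfl | hw
    · exact ⟨0, by simp⟩
    obtain ⟨v, i, r, rfl, hlt, hr⟩ := exists_smul_simpleRoot_eq_eta hw
    obtain ⟨c, hc, -⟩ := ih _ hlt v rfl
    obtain ⟨m, hm⟩ := hμ i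
    refine ⟨c + (m + 1) • r, ?_, fun h0 => ?_⟩
    · rw [mul_weylReflection_smul, hc, hm, hr, eta_add, eta_nsmul, ← Nat.cast_smul_eq_nsmul ℂ]
      push_cast
      abel
    · have hr0 : r = 0 := by simpa using (add_eq_zero.1 h0).2
      have hroot : M.simpleRoot (i : I) = 0 :=
        (smul_eq_zero_iff_eq v).1 (by rw [hr, hr0, eta_zero])
      have hcoroot := M.simpleRoot_coroot_self i
      simp [hroot] at hcoroot

theorem smul_injective {v w : M.weylGroup} (h : v • μ = w • μ) : v = w := by
  obtain ⟨c, hc, hc1⟩ := hμ.exists_smul_eq_sub_eta (w⁻¹ * v)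
  rw [mul_smul, h, inv_smul_smul, eq_comm, sub_eq_self, ← M.eta_zero] at hc
  exact (inv_mul_eq_one.1 (hc1 (M.eta_injective hc))).symm

theorem exists_int_smul_coroot (w : M.weylGroup) (i : M.realIdx) :
    ∃ z : ℤ, (w • μ) (coroot (i : I)) = z := by
  obtain ⟨c, hc, -⟩ := hμ.exists_smul_eq_sub_eta w
  obtain ⟨a, ha⟩ := M.exists_int_eta_coroot c i
  obtain ⟨m, hm⟩ := hμ i
  exact ⟨m + 1 - a, by simp [hc, ha, hm]⟩

theorem eq_one_of_smul {w : M.weylGroup} (hw : M.IsRegularDominant (w • μ)) : w = 1 := by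
  obtain ⟨c, hc, hc1⟩ := hμ.exists_smul_eq_sub_eta w
  obtain ⟨b, hb, -⟩ := hw.exists_smul_eq_sub_eta w⁻¹
  rw [inv_smul_smul, hc, sub_sub, eq_comm, sub_eq_self, ← eta_add, ← M.eta_zero] at hb
  exact hc1 (add_eq_zero.1 (M.eta_injective hb)).1

theorem exists_smul_coroot_neg {w : M.weylGroup} (hw : w ≠ 1) :
    ∃ (i : M.realIdx) (n : ℕ), (w • μ) (coroot (i : I)) = -(n + 1) := by
  by_contra! hnonneg
  refine hw (hμ.eq_one_of_smul fun i => ?_)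
  obtain ⟨z, hz⟩ := hμ.exists_int_smul_coroot w i
  have hz0 : z ≠ 0 := by
    rintro rfl
    have hfix : (M.weylReflection i * w) • μ = w • μ := by
      rw [mul_smul, weylReflection_smul, hz, Int.cast_zero, zero_smul, sub_zero]
    exact weylReflection_ne_one i (mul_eq_right.1 (hμ.smul_injective hfix))
  rcases hz0.lt_or_gt with hneg | hpos
  · obtain ⟨n, hn⟩ := Int.exists_eq_neg_ofNat (Int.add_one_le_of_lt hneg)
    refine absurd ?_ (hnonneg i n)
    rw [hz, eq_sub_of_add_eq hn]
    push_cast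
    ring
  · obtain ⟨m, hm⟩ := Int.eq_ofNat_of_zero_le (Int.sub_nonneg_of_le hpos)
    exact ⟨m, by rw [hz, sub_eq_iff_eq_add.1 hm]; push_cast; ring⟩

end IsRegularDominant

/-! ### Coefficients of `U` in free degrees -/

variable (M) in
/-- The condition `2 (ρ, α_i) = (α_i, α_i)` for the real simple roots, where it reads
`ρ(h_i) = 1`. -/
def IsRealWeylVector (ρ : WeightSpace I) : Prop := ∀ i : M.realIdx, ρ (coroot (i : I)) = 1

theorem IsWeylVector.isRealWeylVector {ρ : WeightSpace I} (hρ : M.IsWeylVector ρ) :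
    M.IsRealWeylVector ρ := fun i => by
  have hd : (M.d i : ℂ) ≠ 0 := by exact_mod_cast (M.d_pos i).ne'
  have h := hρ i
  rw [form_apply, form_simpleRoot, A_self] at h
  apply mul_left_cancel₀ hd
  push_cast at h
  linear_combination h / 2

theorem A_eq_zero_of_not_adj {i j : I} (hij : i ≠ j) (h : ¬ M.quasiDynkin.Adj i j) :
    M.A i j = 0 :=
  by_contra fun hA => h ⟨hij, hA⟩

theorem A_eq_zero_of_form_eq_zero {i j : I} (h : M.form i (M.simpleRoot j) = 0) :
    M.A i j = 0 := by
  simpa [form_simpleRoot, (M.d_pos i).ne'] using h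

theorem IsFree.mono {b k : I →₀ ℕ} (hk : M.IsFree k) (hbk : b ≤ k) : M.IsFree b :=
  fun i hi => (hbk i).trans (hk i hi)

theorem isIndepIndicator_of_mem_Omega {γ : I →₀ ℕ} (hγ : γ ∈ M.Omega) (hle : ∀ i, γ i ≤ 1) :
    IsIndepIndicator M.quasiDynkin γ := by
  refine ⟨hle, fun i j hij => ?_⟩
  by_contra! h
  exact hij.2 (A_eq_zero_of_form_eq_zero (hγ.2.2.1 i j hij.1 h.1 h.2))

theorem mem_Omega_of_isIndepIndicator {β : I →₀ ℕ} (hβ : IsIndepIndicator M.quasiDynkin β)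
    (him : ∀ i, β i ≠ 0 → i ∉ M.realIdx) : β ∈ M.Omega := by
  refine ⟨him, fun i _ => hβ.1 i, fun i j hij hi hj => ?_, fun i _ h2 => ?_⟩
  · rw [form_simpleRoot, A_eq_zero_of_not_adj hij fun h => (hβ.2 i j h).elim hi hj]
    simp
  · exact absurd (hβ.1 i) (by omega)

theorem height_add (b c : I →₀ ℕ) : height (b + c) = height b + height c :=
  map_add Finsupp.degree b c

theorem height_single (i : I) (n : ℕ) : height (Finsupp.single i n) = n :=
  Finsupp.degree_single i n

theorem card_support_le_height (c : I →₀ ℕ) : c.support.card ≤ height c := by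
  rw [Finset.card_eq_sum_ones]
  exact Finset.sum_le_sum fun i hi => Nat.one_le_iff_ne_zero.2 (Finsupp.mem_support_iff.1 hi)

theorem height_le_card_support {c : I →₀ ℕ} (hc : ∀ i, c i ≤ 1) : height c ≤ c.support.card := by
  rw [Finset.card_eq_sum_ones]
  exact Finset.sum_le_sum fun i _ => hc i

theorem height_le_of_smul_eq {ρ : WeightSpace I} {w : M.weylGroup} {γ β : I →₀ ℕ}
    (hβ : ∀ i, β i ≤ 1) (h : w • (ρ - M.eta γ) = ρ - M.eta β) :
    height β ≤ M.length w + height γ := by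
  classical
  obtain ⟨l, rfl, hl⟩ := exists_reduced_word w
  have hsupp : β.support ⊆ (l.map Subtype.val).toFinset ∪ γ.support := fun i hi => by
    by_contra hmem
    simp only [Finset.mem_union, List.mem_toFinset, Finsupp.mem_support_iff, not_or,
      not_not] at hmem
    have hcoord := wordProd_smul_derivation (l := l) (i := i)
      (fun j hj hij => hmem.1 (List.mem_map.2 ⟨j, hj, hij.symm⟩)) (ρ - M.eta γ)
    simp only [h, LinearMap.sub_apply, eta_derivation, hmem.2, Nat.cast_zero, sub_zero,
      sub_eq_self, Nat.cast_eq_zero] at hcoord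
    exact Finsupp.mem_support_iff.1 hi hcoord
  calc height β ≤ β.support.card := height_le_card_support hβ
    _ ≤ (l.map Subtype.val).toFinset.card + γ.support.card :=
      (Finset.card_le_card hsupp).trans (Finset.card_union_le _ _)
    _ ≤ M.length (M.wordProd l) + height γ := by
      gcongr
      · exact (List.toFinset_card_le _).trans_eq (by rw [List.length_map, hl])
      · exact card_support_le_height γ

theorem mem_termsAt {ρ : WeightSpace I} {β : I →₀ ℕ} {p : M.weylGroup × M.Omega} :
    p ∈ M.termsAt ρ β ↔ p.1 • (ρ - M.eta p.2) = ρ - M.eta β := by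
  rw [sub_eq_add_neg ρ (M.eta β), add_comm, ← sub_eq_iff_eq_add]
  rfl

theorem apply_eq_of_mem_termsAt {ρ : WeightSpace I} {β : I →₀ ℕ} {p : M.weylGroup × M.Omega}
    (hp : p ∈ M.termsAt ρ β) {i : I} (hi : i ∉ M.realIdx) : (p.2 : I →₀ ℕ) i = β i := by
  have h := smul_derivation p.1 hi (ρ - M.eta p.2)
  rw [mem_termsAt.1 hp, LinearMap.sub_apply, LinearMap.sub_apply, sub_right_inj, eta_derivation,
    eta_derivation] at h
  exact_mod_cast h.symm

theorem le_one_of_mem_termsAt {ρ : WeightSpace I} {β : I →₀ ℕ} {p : M.weylGroup × M.Omega}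
    (hβ : M.IsFree β) (hp : p ∈ M.termsAt ρ β) (i : I) : β i ≤ 1 := by
  by_cases hi : i ∈ M.realIdx ∪ M.oddNull
  · exact hβ i hi
  obtain ⟨hre, hnull⟩ := not_or.1 hi
  obtain ⟨-, heven, -, hodd⟩ := p.2.2
  rw [← apply_eq_of_mem_termsAt hp hre]
  by_cases ho : i ∈ M.odd
  · by_contra! h2
    exact hnull ⟨ho, A_eq_zero_of_form_eq_zero (hodd i ho h2)⟩
  · exact heven i ho

namespace IsRealWeylVector

variable {ρ : WeightSpace I} (hρ : M.IsRealWeylVector ρ)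

include hρ

theorem isRegularDominant_sub_eta {γ : I →₀ ℕ} (hγ : γ ∈ M.Omega) :
    M.IsRegularDominant (ρ - M.eta γ) := fun i => by
  obtain ⟨m, hm⟩ := M.exists_nat_eta_coroot (c := γ) (i := i)
    (by_contra fun h => hγ.1 i h i.2)
  exact ⟨m, by rw [LinearMap.sub_apply, hρ i, hm]; ring⟩

theorem exists_mem_termsAt (w : M.weylGroup) (γ : M.Omega) : ∃ β, (w, γ) ∈ M.termsAt ρ β := by
  obtain ⟨c, hc, -⟩ := (hρ.isRegularDominant_sub_eta γ.2).exists_smul_eq_sub_eta w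
  exact ⟨γ + c, mem_termsAt.2 (by rw [hc, eta_add, sub_sub])⟩

theorem termsAt_subsingleton (β : I →₀ ℕ) : (M.termsAt ρ β).Subsingleton := by
  rintro ⟨v, γ⟩ hv ⟨w, γ'⟩ hw
  have hγ : γ = γ' := by
    ext i
    by_cases hi : i ∈ M.realIdx
    · rw [by_contra fun h => γ.2.1 i h hi, by_contra fun h => γ'.2.1 i h hi]
    · rw [apply_eq_of_mem_termsAt hv hi, apply_eq_of_mem_termsAt hw hi]
  subst hγ
  have hvw : v = w := (hρ.isRegularDominant_sub_eta γ.2).smul_injective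
    ((mem_termsAt.1 hv).trans (mem_termsAt.1 hw).symm)
  rw [hvw]

theorem exists_eq_add_single_of_coroot {β : I →₀ ℕ} {i : M.realIdx} {n : ℕ} (hβ : β i ≤ 1)
    (hn : (ρ - M.eta β) (coroot (i : I)) = -(n + 1)) :
    ∃ β', β' (i : I) = 0 ∧ β = β' + Finsupp.single (i : I) 1 ∧ (∀ j, β' j ≠ 0 → M.A i j = 0) ∧
      M.weylReflection i • (ρ - M.eta β) = ρ - M.eta β' := by
  have hval : M.eta β (coroot (i : I)) = n + 2 := by
    rw [LinearMap.sub_apply, hρ i] at hn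
    linear_combination -hn
  have hβi : β i = 1 := by
    refine le_antisymm hβ (Nat.one_le_iff_ne_zero.2 fun h0 => ?_)
    obtain ⟨m, hm⟩ := M.exists_nat_eta_coroot h0
    have hsum : (n + 2 + m : ℂ) = 0 := by rw [← hval, hm]; ring
    exact absurd hsum (by exact_mod_cast (by omega : n + 2 + m ≠ 0))
  obtain ⟨β', h0, rfl⟩ := exists_eq_add_single_of_apply_eq_one hβi
  -- The value `n` of `η(β')` at `h_i` is also nonpositive, so both vanish.
  obtain ⟨m, hm⟩ := M.exists_nat_eta_coroot h0
  have hmn : n + m = 0 := by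
    rw [eta_add, eta_single, one_smul, LinearMap.add_apply, simpleRoot_coroot_self, hm] at hval
    exact_mod_cast (by linear_combination -hval : (n : ℂ) + m = 0)
  obtain ⟨rfl, rfl⟩ := Nat.add_eq_zero_iff.1 hmn
  refine ⟨β', h0, rfl, (M.eta_coroot_eq_zero_iff h0).1 (by simpa using hm), ?_⟩
  rw [weylReflection_smul, hn, eta_add, eta_single]
  module

theorem isIndepIndicator_of_smul_eq {w : M.weylGroup} {γ β : I →₀ ℕ} (hγ : γ ∈ M.Omega)
    (hβ : ∀ i, β i ≤ 1) (h : w • (ρ - M.eta γ) = ρ - M.eta β) :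
    IsIndepIndicator M.quasiDynkin β := by
  induction hn : height β using Nat.strong_induction_on generalizing w β with
  | _ n ih =>
    subst hn
    rcases eq_or_ne w 1 with rfl | hw
    · rw [one_smul, sub_right_inj] at h
      exact M.eta_injective h ▸ isIndepIndicator_of_mem_Omega hγ (M.eta_injective h ▸ hβ)
    · obtain ⟨i, n, hin⟩ := (hρ.isRegularDominant_sub_eta hγ).exists_smul_coroot_neg hw
      rw [h] at hin
      obtain ⟨β, hi, rfl, hA, hrefl⟩ := hρ.exists_eq_add_single_of_coroot (hβ i) hin
      rw [isIndepIndicator_add_single hi]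
      refine ⟨ih _ ?_ (w := M.weylReflection i * w) (fun j => le_self_add.trans (hβ j)) ?_ rfl,
        fun j hj hij => hij.2 (hA j hj)⟩
      · rw [height_add, height_single]
        exact Nat.lt_succ_self _
      · rw [mul_smul, h, hrefl]

theorem exists_smul_eq_of_isIndepIndicator {β : I →₀ ℕ}
    (hβ : IsIndepIndicator M.quasiDynkin β) :
    ∃ w : M.weylGroup, ∃ γ ∈ M.Omega, w • (ρ - M.eta γ) = ρ - M.eta β ∧
      M.length w + height γ ≤ height β := by
  induction hn : height β using Nat.strong_induction_on generalizing β with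
  | _ n ih =>
    subst hn
    by_cases hre : ∃ i : M.realIdx, β i ≠ 0
    · obtain ⟨i, hi⟩ := hre
      have hβi : β i = 1 := le_antisymm (hβ.1 i) (Nat.one_le_iff_ne_zero.2 hi)
      obtain ⟨β, hi0, rfl⟩ := exists_eq_add_single_of_apply_eq_one hβi
      obtain ⟨hβ', hnbr⟩ := (isIndepIndicator_add_single hi0).1 hβ
      have hheight : height (β + Finsupp.single (i : I) 1) = height β + 1 := by
        rw [height_add, height_single]
      obtain ⟨w, γ, hγ, hw, hlen⟩ := ih _ (by omega) hβ' rfl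
      have horth : M.eta β (coroot (i : I)) = 0 := (M.eta_coroot_eq_zero_iff hi0).2 fun j hj =>
        A_eq_zero_of_not_adj (by rintro rfl; exact hj hi0) (hnbr j hj)
      refine ⟨M.weylReflection i * w, γ, hγ, ?_, ?_⟩
      · rw [mul_smul, hw, weylReflection_smul, LinearMap.sub_apply, hρ i, horth, eta_add,
          eta_single]
        module
      · have := length_weylReflection_mul_le i w
        omega
    · push Not at hre
      exact ⟨1, β, mem_Omega_of_isIndepIndicator hβ fun i hi hi' => hi (hre ⟨i, hi'⟩), by simp,
        by simp⟩

theorem coeff_U {β : I →₀ ℕ} (hβ : M.IsFree β) :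
    MvPowerSeries.coeff β (M.U ρ) =
      MvPowerSeries.coeff β (indepSeries ℂ M.quasiDynkin) := by
  classical
  rw [coeff_indepSeries]
  change ∑ᶠ p ∈ M.termsAt ρ β, (-1 : ℂ) ^ M.length p.1 * (-1 : ℂ) ^ height (p.2 : I →₀ ℕ) = _
  split_ifs with hindep
  · obtain ⟨w, γ, hγ, hw, hlen⟩ := hρ.exists_smul_eq_of_isIndepIndicator hindep
    have hsingle : M.termsAt ρ β = {(w, ⟨γ, hγ⟩)} :=
      (hρ.termsAt_subsingleton β).eq_singleton_of_mem (mem_termsAt.2 hw)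
    rw [hsingle, finsum_mem_singleton, ← pow_add,
      le_antisymm hlen (height_le_of_smul_eq hindep.1 hw)]
  · have hempty : M.termsAt ρ β = ∅ := Set.eq_empty_iff_forall_notMem.2 fun p hp =>
      hindep (hρ.isIndepIndicator_of_smul_eq p.2.2 (le_one_of_mem_termsAt hβ hp)
        (mem_termsAt.1 hp))
    rw [hempty, finsum_mem_empty]

theorem isUnit_U : IsUnit (M.U ρ) := by
  have hfree : M.IsFree 0 := fun i _ => by simp
  rw [MvPowerSeries.isUnit_iff_constantCoeff, ← MvPowerSeries.coeff_zero_eq_constantCoeff_apply,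
    hρ.coeff_U hfree, MvPowerSeries.coeff_zero_eq_constantCoeff_apply, constantCoeff_indepSeries]
  exact isUnit_one

end IsRealWeylVector

end BKMSupermatrix

/-! ### Multicolorings -/

section Multicoloring

variable {I : Type*} {G : SimpleGraph I} {k : I →₀ ℕ} {q : ℕ}

theorem card_filter_ne_zero_of_sum_eq {f : Fin q → I →₀ ℕ} (hsum : ∑ c, f c = k)
    (hle : ∀ c i, f c i ≤ 1) (i : I) :
    (Finset.univ.filter fun c => f c i ≠ 0).card = k i := by
  rw [Finset.card_filter, ← hsum, Finsupp.finsetSum_apply]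
  refine Finset.sum_congr rfl fun c _ => ?_
  have := hle c i
  split_ifs <;> omega

/-- The indicator function of the color class of `c` in a multicoloring. -/
def colorClass (τ : Multicoloring G k q) (c : Fin q) : I →₀ ℕ :=
  Finsupp.onFinset k.support (fun i => if c ∈ τ.1 i then 1 else 0) fun i hi => by
    rw [Finsupp.mem_support_iff, ← τ.2.1 i]
    exact Finset.card_ne_zero_of_mem (of_not_not fun h => hi (if_neg h))

theorem colorClass_apply (τ : Multicoloring G k q) (c : Fin q) (i : I) :
    colorClass τ c i = if c ∈ τ.1 i then 1 else 0 :=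
  rfl

theorem sum_colorClass (τ : Multicoloring G k q) : ∑ c, colorClass τ c = k := by
  ext i
  simp [Finsupp.finsetSum_apply, colorClass_apply, ← τ.2.1 i]

theorem isIndepIndicator_colorClass (τ : Multicoloring G k q) (c : Fin q) :
    IsIndepIndicator G (colorClass τ c) := by
  refine ⟨fun i => ?_, fun i j hij => ?_⟩
  · rw [colorClass_apply]
    split_ifs <;> simp
  · simp only [colorClass_apply, ite_eq_right_iff, one_ne_zero, imp_false]
    by_contra! h
    exact Finset.disjoint_left.1 (τ.2.2 i j hij) h.1 h.2

variable (G k q) in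
/-- A multicoloring is the same as the tuple of its color classes, a decomposition of `k` into
indicator functions of independent sets. -/
def multicoloringEquiv :
    Multicoloring G k q ≃
      {f : Fin q → I →₀ ℕ // ∑ c, f c = k ∧ ∀ c, IsIndepIndicator G (f c)} where
  toFun τ := ⟨colorClass τ, sum_colorClass τ, isIndepIndicator_colorClass τ⟩
  invFun f := ⟨fun i => Finset.univ.filter fun c => f.1 c i ≠ 0,
    card_filter_ne_zero_of_sum_eq f.2.1 fun c => (f.2.2 c).1, fun i j hij =>
      Finset.disjoint_filter.2 fun c _ hi hj => ((f.2.2 c).2 i j hij).elim hi hj⟩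
  left_inv τ := by
    refine Subtype.ext (funext fun i => Finset.ext fun c => ?_)
    simp [colorClass_apply]
  right_inv f := by
    ext c i
    have := (f.2.2 c).1 i
    refine (colorClass_apply _ c i).trans ?_
    simp only [Finset.mem_filter, Finset.mem_univ, true_and]
    split_ifs <;> omega

open Classical in
theorem natCard_multicoloring (G : SimpleGraph I) (k : I →₀ ℕ) (q : ℕ) :
    Nat.card (Multicoloring G k q) =
      ((Finset.finsuppAntidiag (Finset.univ : Finset (Fin q)) k).filter fun f =>
        ∀ c, IsIndepIndicator G (f c)).card := by
  rw [Nat.card_congr (multicoloringEquiv G k q), ← Nat.card_eq_finsetCard]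
  refine Nat.card_congr (Finsupp.equivFunOnFinite.subtypeEquiv fun f => ?_).symm
  simp

open Classical in
theorem prod_coeff_indepSeries {R : Type*} [CommRing R] (f : Fin q → I →₀ ℕ) :
    ∏ c, MvPowerSeries.coeff (f c) (indepSeries R G) =
      if ∀ c, IsIndepIndicator G (f c) then (-1) ^ BKMSupermatrix.height (∑ c, f c) else 0 := by
  simp only [coeff_indepSeries]
  split_ifs with h
  · simp only [if_pos (h _), Finset.prod_pow_eq_pow_sum]
    exact congrArg _ (map_sum Finsupp.degree f Finset.univ).symm
  · obtain ⟨c, hc⟩ := not_forall.1 h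
    exact Finset.prod_eq_zero (Finset.mem_univ c) (if_neg hc)

theorem coeff_pow_eq_natCard_multicoloring {R : Type*} [CommRing R] {F : MvPowerSeries I R}
    (hF : ∀ β ≤ k, MvPowerSeries.coeff β F = MvPowerSeries.coeff β (indepSeries R G)) (q : ℕ) :
    MvPowerSeries.coeff k (F ^ q) =
      (-1) ^ BKMSupermatrix.height k * (Nat.card (Multicoloring G k q) : R) := by
  classical
  have hterm : ∀ f ∈ Finset.finsuppAntidiag (Finset.univ : Finset (Fin q)) k,
      ∏ c, MvPowerSeries.coeff (f c) F =
        if ∀ c, IsIndepIndicator G (f c) then (-1) ^ BKMSupermatrix.height k else 0 := by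
    intro f hf
    have hsum : ∑ c, f c = k := (Finset.mem_finsuppAntidiag.1 hf).1
    have hle (c : Fin q) : f c ≤ k :=
      hsum ▸ Finset.single_le_sum (f := fun c => f c) (fun _ _ => zero_le) (Finset.mem_univ c)
    rw [Finset.prod_congr rfl fun c _ => hF (f c) (hle c), prod_coeff_indepSeries, hsum]
  calc MvPowerSeries.coeff k (F ^ q) = MvPowerSeries.coeff k (∏ _c : Fin q, F) := by simp
    _ = _ := by
      rw [MvPowerSeries.coeff_prod, Finset.sum_congr rfl hterm, ← Finset.sum_filter,
        Finset.sum_const, nsmul_eq_mul, mul_comm, natCard_multicoloring]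

end Multicoloring

/-! ### Integral powers of power series -/

section IntegralPowers

variable {σ : Type*}

theorem coe_zpow_eq_subst_binomialSeries {R : Type*} [CommRing R] (u : (MvPowerSeries σ R)ˣ)
    (hu : MvPowerSeries.constantCoeff (u : MvPowerSeries σ R) = 1) (q : ℤ) :
    ((u ^ q : (MvPowerSeries σ R)ˣ) : MvPowerSeries σ R) =
      (PowerSeries.binomialSeries R q).subst ((u : MvPowerSeries σ R) - 1) := by
  have ha : PowerSeries.HasSubst ((u : MvPowerSeries σ R) - 1) :=
    .of_constantCoeff_zero (by simp [hu])
  let φ : Multiplicative ℤ →* MvPowerSeries σ R :=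
    { toFun q := PowerSeries.substAlgHom ha (PowerSeries.binomialSeries R q.toAdd)
      map_one' := by simp
      map_mul' := by simp }
  suffices (Units.coeHom _).comp (zpowersHom _ u) = φ by
    simpa [φ, PowerSeries.coe_substAlgHom] using DFunLike.congr_fun this (Multiplicative.ofAdd q)
  ext
  have h1 : PowerSeries.binomialSeries R (1 : ℤ) = 1 + PowerSeries.X := by
    simpa using PowerSeries.binomialSeries_nat (R := ℤ) (A := R) 1
  simp [φ, h1, PowerSeries.substAlgHom_X]

theorem coeff_subst_eq_sum_range {R : Type*} [CommRing R] {a : MvPowerSeries σ R}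
    (ha : MvPowerSeries.constantCoeff a = 0) (f : PowerSeries R) (k : σ →₀ ℕ) :
    MvPowerSeries.coeff k (f.subst a) =
      ∑ m ∈ Finset.range (k.degree + 1),
        PowerSeries.coeff m f * MvPowerSeries.coeff k (a ^ m) := by
  rw [PowerSeries.coeff_subst (.of_constantCoeff_zero ha)]
  refine finsum_eq_sum_of_support_subset _ fun m hm => ?_
  by_contra hlt
  rw [Finset.mem_coe, Finset.mem_range, not_lt, Nat.succ_le_iff] at hlt
  exact hm <| mul_eq_zero_of_right _ <| MvPowerSeries.coeff_of_lt_order <|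
    (Nat.cast_lt.2 hlt).trans_le (MvPowerSeries.le_order_pow_of_constantCoeff_eq_zero m ha)

theorem descPochhammer_eval_intCast {K : Type*} [CommRing K] (q : ℤ) (m : ℕ) :
    (descPochhammer K m).eval (q : K) = m.factorial * ((Ring.choose q m : ℤ) : K) := by
  have h := Ring.descPochhammer_eq_factorial_smul_choose q m
  rw [← eval_eq_smeval, nsmul_eq_mul] at h
  rw [← descPochhammer_eval_cast, h]
  push_cast
  rfl

theorem exists_polynomial_eval_eq_coeff_zpow {K : Type*} [Field K] [CharZero K]
    (u : (MvPowerSeries σ K)ˣ) (hu : MvPowerSeries.constantCoeff (u : MvPowerSeries σ K) = 1)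
    (k : σ →₀ ℕ) :
    ∃ P : K[X], ∀ q : ℤ,
      P.eval (q : K) =
        MvPowerSeries.coeff k ((u ^ q : (MvPowerSeries σ K)ˣ) : MvPowerSeries σ K) := by
  refine ⟨∑ m ∈ Finset.range (k.degree + 1),
    C (MvPowerSeries.coeff k (((u : MvPowerSeries σ K) - 1) ^ m) / (m.factorial : K)) *
      descPochhammer K m, fun q => ?_⟩
  rw [coe_zpow_eq_subst_binomialSeries u hu, coeff_subst_eq_sum_range (by simp [hu]),
    eval_finsetSum]
  refine Finset.sum_congr rfl fun m _ => ?_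
  have hm : (m.factorial : K) ≠ 0 := Nat.cast_ne_zero.2 m.factorial_ne_zero
  rw [eval_mul, eval_C, descPochhammer_eval_intCast, PowerSeries.binomialSeries_coeff,
    zsmul_one]
  field_simp

end IntegralPowers

section ChromaticPolynomial

variable {I : Type*} {G : SimpleGraph I} {k : I →₀ ℕ}

theorem exists_isChromaticPolynomial (G : SimpleGraph I) (k : I →₀ ℕ) :
    ∃ P : ℚ[X], IsChromaticPolynomial G k P := by
  have hconst := constantCoeff_indepSeries (R := ℚ) G
  obtain ⟨u, hu⟩ : IsUnit (indepSeries ℚ G) := by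
    rw [MvPowerSeries.isUnit_iff_constantCoeff, hconst]
    exact isUnit_one
  obtain ⟨P, hP⟩ := exists_polynomial_eval_eq_coeff_zpow u (hu ▸ hconst) k
  refine ⟨C ((-1) ^ BKMSupermatrix.height k) * P, fun q => ?_⟩
  have hq := hP q
  rw [zpow_natCast, Units.val_pow_eq_pow_val, hu,
    coeff_pow_eq_natCard_multicoloring fun _ _ => rfl, Int.cast_natCast] at hq
  rw [eval_mul, eval_C, hq, ← mul_assoc, pow_mul_pow_eq_one _ (by norm_num), one_mul]

theorem coeff_zpow_eq_eval_chromaticPolynomial {K : Type*} [Field K] [CharZero K]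
    {u : (MvPowerSeries I K)ˣ}
    (hu : ∀ β ≤ k, MvPowerSeries.coeff β (u : MvPowerSeries I K) =
      MvPowerSeries.coeff β (indepSeries K G))
    {P : ℚ[X]} (hP : IsChromaticPolynomial G k P) (q : ℤ) :
    MvPowerSeries.coeff k ((u ^ q : (MvPowerSeries I K)ˣ) : MvPowerSeries I K) =
      (-1) ^ BKMSupermatrix.height k * ((P.eval (q : ℚ) : ℚ) : K) := by
  have hconst : MvPowerSeries.constantCoeff (u : MvPowerSeries I K) = 1 :=
    (hu 0 zero_le).trans (constantCoeff_indepSeries G)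
  obtain ⟨Q, hQ⟩ := exists_polynomial_eval_eq_coeff_zpow u hconst k
  have heval (q : ℤ) :
      (C ((-1) ^ BKMSupermatrix.height k) * P.map (algebraMap ℚ K)).eval (q : K) =
        (-1) ^ BKMSupermatrix.height k * ((P.eval (q : ℚ) : ℚ) : K) := by
    rw [eval_mul, eval_C, eval_intCast_map, eq_ratCast]
  have hagree (n : ℕ) :
      Q.eval (n : K) =
        (C ((-1) ^ BKMSupermatrix.height k) * P.map (algebraMap ℚ K)).eval (n : K) := by
    have hQn := hQ n
    have hPn := heval n
    rw [Int.cast_natCast] at hQn hPn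
    rw [hQn, hPn, zpow_natCast, Units.val_pow_eq_pow_val, coeff_pow_eq_natCard_multicoloring hu,
      Int.cast_natCast, hP n, Rat.cast_natCast]
  have hQP : Q = C ((-1) ^ BKMSupermatrix.height k) * P.map (algebraMap ℚ K) :=
    eq_of_infinite_eval_eq _ _ <|
      (Set.infinite_range_of_injective Nat.cast_injective).mono (Set.range_subset_iff.2 hagree)
  rw [← hQ, hQP, heval]

end ChromaticPolynomial

end

theorem mainTheorem7_general {I : Type*} (M : BKMSupermatrix I)
    (ρ : WeightSpace I) (hρ : M.IsRealWeylVector ρ) :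
    (∀ (w : M.weylGroup) (γ : M.Omega), ∃ β : I →₀ ℕ, (w, γ) ∈ M.termsAt ρ β) ∧
    (∀ β : I →₀ ℕ, (M.termsAt ρ β).Finite) ∧
    ∃ u : (MvPowerSeries I ℂ)ˣ, (u : MvPowerSeries I ℂ) = M.U ρ ∧
      ∀ k : I →₀ ℕ, M.IsFree k →
        ∃ P : Polynomial ℚ, IsChromaticPolynomial M.quasiDynkin k P ∧
          ∀ q : ℤ, MvPowerSeries.coeff k ((u ^ q : (MvPowerSeries I ℂ)ˣ) : MvPowerSeries I ℂ) =
            (-1 : ℂ) ^ BKMSupermatrix.height k * ((P.eval (q : ℚ) : ℚ) : ℂ) := by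
  obtain ⟨u, hu⟩ := hρ.isUnit_U
  refine ⟨hρ.exists_mem_termsAt, fun β => (hρ.termsAt_subsingleton β).finite, u, hu,
    fun k hk => ?_⟩
  obtain ⟨P, hP⟩ := exists_isChromaticPolynomial M.quasiDynkin k
  refine ⟨P, hP, coeff_zpow_eq_eval_chromaticPolynomial (fun β hβ => ?_) hP⟩
  rw [hu, hρ.coeff_U (hk.mono hβ)]

/-- `U` is a well-defined formal power series (every exponent lies in `-Q₊` and occurs finitely
often) which is invertible, and for free `k` and all `q ∈ ℤ` the coefficient of `e^{-η(k)}`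
in `U ^ q` is `(-1) ^ ht(η(k))` times the value at `q` of the `k`-chromatic polynomial. -/
theorem mainTheorem7 {I : Type*} [Countable I] (M : BKMSupermatrix I)
    (ρ : WeightSpace I) (hρ : M.IsWeylVector ρ) :
    (∀ (w : M.weylGroup) (γ : M.Omega), ∃ β : I →₀ ℕ, (w, γ) ∈ M.termsAt ρ β) ∧
    (∀ β : I →₀ ℕ, (M.termsAt ρ β).Finite) ∧
    ∃ u : (MvPowerSeries I ℂ)ˣ, (u : MvPowerSeries I ℂ) = M.U ρ ∧
      ∀ k : I →₀ ℕ, M.IsFree k →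
        ∃ P : Polynomial ℚ, IsChromaticPolynomial M.quasiDynkin k P ∧
          ∀ q : ℤ, MvPowerSeries.coeff k ((u ^ q : (MvPowerSeries I ℂ)ˣ) : MvPowerSeries I ℂ) =
            (-1 : ℂ) ^ BKMSupermatrix.height k * ((P.eval (q : ℚ) : ℚ) : ℂ) :=
  mainTheorem7_general M ρ hρ.isRealWeylVector
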